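/- Let $n\ge 2$ and let $D_n$ be the Coxeter group with generators $s_{1'},s_1,\dots,s_{n-1}$ and relations: every generator is an involution, $(s_is_{i+1})^3=1$ for $1\le i\le n-2$, $(s_{1'}s_2)^3=1$ (if $n\ge 3$), and any other two distinct generators commute. Let $\ell$ be its Coxeter length, and let $S_n^\circ\le D_n$ be the subgroup generated by $s_1,\dots,s_{n-1}$. Let $S_n$ be the group of permutations of $\{1,\dots,n\}$, multiplied from left to right, with $s_i=(i,i+1)$; for $\sigma\in S_n$ let $\ell(\sigma)$ be the number of inversions of $\sigma$, and let $\mathrm{maj}(\sigma)=\sum_{\sigma(i)>\sigma(i+1)} i$. Let $\Phi:D_n\to S_n$ be the homomorphism with $\Phi(s_{1'})=s_1$ and $\Phi(s_i)=s_i$, and write $\pi'=\Phi(\pi)$. Put $t_k=s_1s_2\cdots s_{k-1}\in S_n$ for $2\le k\le n$, and $w_L=s_Ls_{L-1}\cdots s_1\,s_{1'}\,s_2s_3\cdots s_L\in D_n$ for $1\le L\le n-1$. Let $\pi\in D_n$ be such that $\pi'=t_{k_1}^{i_{k_1}}\cdots t_{k_m}^{i_{k_m}}$ with $m\ge 1$,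 $2\le k_1<\dots<k_m\le n$ and $0<i_{k_j}<k_j$, and such that $\pi'$ is a standard OGS elementary element, i.e. $\sum_{j=1}^m i_{k_j}\le k_1$. Assume that $\pi=w_L\cdot\pi^\circ$ with $1\le L\le n-1$ and $\pi^\circ\in S_n^\circ$. Then: - if $L<\sum_{j=1}^m i_{k_j}$, then $\ell(\pi)=2L+\ell(\pi')$; - if $L=\sum_{j=1}^m i_{k_j}<k_1$, then $\ell(\pi)=\ell(\pi')$; - if $\sum_{j=1}^m i_{k_j}<L<k_1$, then $\ell(\pi)=2\,(L-\mathrm{maj}(\pi'))+\ell(\pi')$; - if $k_r\le L<k_{r+1}$ for some $1\le r\le m-1$, then $\ell(\pi)=2\,\bigl(L-\sum_{j=r+1}^m i_{k_j}\bigr)+\ell(\pi')$; - if $L\ge k_m$, then $\ell(\pi)=2L+\ell(\pi')$. -/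

import Mathlib

namespace TypeD

/-- The Coxeter matrix of type `D_n`. Index `0` stands for the generator `s_{1'}` and index
`i` with `1 ≤ i ≤ n - 1` for the generator `s_i`: the generators `s_1, …, s_{n-1}` form a path,
and `s_{1'}` is joined to `s_2` only. (This is not `CoxeterMatrix.D`, whose last three nodes
form a triangle.) -/
def coxeterMatrix (n : ℕ) : CoxeterMatrix (Fin n) where
  M := Matrix.of fun a b : Fin n ↦
    if a = b then 1
    else if (a : ℕ) = 0 then (if (b : ℕ) = 2 then 3 else 2)
    else if (b : ℕ) = 0 then (if (a : ℕ) = 2 then 3 else 2)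
    else if (a : ℕ) + 1 = b ∨ (b : ℕ) + 1 = a then 3 else 2
  isSymm := by
    ext a b
    simp only [Matrix.transpose_apply, Matrix.of_apply, Fin.ext_iff]
    split_ifs <;> first | rfl | omega
  diagonal := by simp
  off_diagonal := by
    intro a b h
    simp only [Matrix.of_apply]
    split_ifs <;> simp_all

/-- The Coxeter group `D_n`, given by its Coxeter presentation. -/
abbrev D (n : ℕ) : Type := (coxeterMatrix n).Group

/-- The Coxeter length `ℓ` on `D_n` with respect to `s_{1'}, s_1, …, s_{n-1}`. -/
noncomputable def length {n : ℕ} (π : D n) : ℕ :=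
  (coxeterMatrix n).toCoxeterSystem.length π

/-- The generators of `D_n`: `gen n 0 = s_{1'}` and `gen n i = s_i` for `1 ≤ i ≤ n - 1`
(the value at an index outside this range is irrelevant). -/
def gen (n i : ℕ) : D n :=
  if h : i < n then (coxeterMatrix n).simple ⟨i, h⟩ else 1

/-- The symmetric group `S_n` on `{1, …, n}` (here `Fin n`, the number `i` being represented by
`i - 1`), with permutations multiplied from left to right, hence the opposite of Mathlib's
group. The permutation underlying `σ : S n` is `σ.unop`. -/
abbrev S (n : ℕ) : Type := (Equiv.Perm (Fin n))ᵐᵒᵖ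

/-- The generator `s_i` of `S_n`, `1 ≤ i ≤ n - 1`, which is the transposition `(i, i + 1)`
(the value at an index outside this range is irrelevant). -/
def sgen (n i : ℕ) : S n :=
  MulOpposite.op
    (if h : 1 ≤ i ∧ i < n then Equiv.swap ⟨i - 1, by omega⟩ ⟨i, h.2⟩ else 1)

/-- The length of a permutation: the number of its inversions. -/
def inversions {n : ℕ} (σ : Equiv.Perm (Fin n)) : ℕ :=
  (Finset.univ.filter fun p : Fin n × Fin n ↦ p.1 < p.2 ∧ σ p.2 < σ p.1).card

/-- The major index of a permutation: the sum of the locations `i`, `1 ≤ i ≤ n - 1`, of its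
descents. The location `i` is a descent when the image of `i + 1` is smaller than the image
of `i`; the latter two are represented by `i` and `i - 1` in `Fin n`. -/
def maj {n : ℕ} (σ : Equiv.Perm (Fin n)) : ℕ :=
  ∑ i ∈ Finset.Ico 1 n,
    if ∃ h : i < n, σ ⟨i, h⟩ < σ ⟨i - 1, by omega⟩ then i else 0

/-- `t_k = s_1 * s_2 * ⋯ * s_{k-1}`, for a given family `s` in a monoid. -/
def t {G : Type*} [Monoid G] (s : ℕ → G) (k : ℕ) : G :=
  ((List.range (k - 1)).map fun j ↦ s (j + 1)).prod

/-- `w_L = (s_L * s_{L-1} * ⋯ * s_1) * s_{1'} * (s_2 * s_3 * ⋯ * s_L)` in `D_n`. -/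
def w (n L : ℕ) : D n :=
  ((List.range L).map fun j ↦ gen n (L - j)).prod * gen n 0 *
    ((List.range (L - 1)).map fun j ↦ gen n (j + 2)).prod

/-- The subgroup `S_n°` of `D_n`: the parabolic subgroup generated by `s_1, …, s_{n-1}`. -/
def parabolic (n : ℕ) : Subgroup (D n) :=
  Subgroup.closure {g | ∃ i, 1 ≤ i ∧ i < n ∧ g = gen n i}

theorem sgen_sq (n i : ℕ) : sgen n i * sgen n i = 1 := by
  unfold sgen
  rw [← MulOpposite.op_mul]
  split_ifs <;> simp

theorem sgen_comm (n i j : ℕ) (h : i + 1 < j) : (sgen n i * sgen n j) ^ 2 = 1 := by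
  have hc : sgen n i * sgen n j = sgen n j * sgen n i := by
    unfold sgen
    rw [← MulOpposite.op_mul, ← MulOpposite.op_mul]
    congr 1
    split_ifs with h1 h2 h2
    · apply Equiv.Perm.Disjoint.commute
      rw [Equiv.Perm.disjoint_iff_disjoint_support, Equiv.Perm.support_swap,
        Equiv.Perm.support_swap]
      · simp [Fin.ext_iff]; omega
      · simp [Fin.ext_iff]; omega
      · simp [Fin.ext_iff]; omega
    all_goals simp
  calc (sgen n i * sgen n j) ^ 2 = (sgen n i * sgen n j) * (sgen n j * sgen n i) := by
        rw [pow_two, ← hc]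
    _ = sgen n i * (sgen n j * sgen n j) * sgen n i := by simp only [mul_assoc]
    _ = 1 := by rw [sgen_sq, mul_one, sgen_sq]

theorem sgen_braid (n i : ℕ) (h1 : 1 ≤ i) (h2 : i + 1 < n) :
    sgen n i * sgen n (i + 1) * sgen n i = sgen n (i + 1) * sgen n i * sgen n (i + 1) := by
  unfold sgen
  rw [dif_pos ⟨h1, by omega⟩, dif_pos ⟨by omega, h2⟩]
  simp only [← MulOpposite.op_mul]
  congr 1
  ext x
  simp only [Equiv.Perm.mul_apply, Equiv.swap_apply_def, Fin.ext_iff]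
  simp only [apply_ite Fin.val, Nat.add_sub_cancel]
  split_ifs <;> omega

theorem sgen_adj (n i : ℕ) (h1 : 1 ≤ i) (h2 : i + 1 < n) :
    (sgen n i * sgen n (i + 1)) ^ 3 = 1 ∧ (sgen n (i + 1) * sgen n i) ^ 3 = 1 := by
  have hb := sgen_braid n i h1 h2
  have ha := sgen_sq n i
  have hc := sgen_sq n (i + 1)
  generalize sgen n i = a at *
  generalize sgen n (i + 1) = b at *
  constructor
  · calc (a * b) ^ 3 = (a * b * a) * (b * a * b) := by simp only [pow_succ, pow_zero, one_mul, mul_assoc]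
      _ = (b * a * b) * (b * a * b) := by rw [hb]
      _ = b * a * (b * b) * a * b := by simp only [mul_assoc]
      _ = b * (a * a) * b := by rw [hc]; simp only [mul_assoc, one_mul]
      _ = 1 := by rw [ha, mul_one, hc]
  · calc (b * a) ^ 3 = (b * a * b) * (a * b * a) := by simp only [pow_succ, pow_zero, one_mul, mul_assoc]
      _ = (b * a * b) * (b * a * b) := by rw [hb]
      _ = b * a * (b * b) * a * b := by simp only [mul_assoc]
      _ = b * (a * a) * b := by rw [hc]; simp only [mul_assoc, one_mul]
      _ = 1 := by rw [ha, mul_one, hc]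

theorem sgen_comm_symm (n i j : ℕ) (h : i + 1 < j) : (sgen n j * sgen n i) ^ 2 = 1 := by
  rw [← inv_inj, inv_one, ← inv_pow, mul_inv_rev,
    inv_eq_of_mul_eq_one_right (sgen_sq n i), inv_eq_of_mul_eq_one_right (sgen_sq n j)]
  exact sgen_comm n i j h

theorem isLiftable_sgen (n : ℕ) :
    (coxeterMatrix n).IsLiftable fun a : Fin n ↦ sgen n (max 1 (a : ℕ)) := by
  rintro ⟨a, ha⟩ ⟨b, hb⟩
  simp only [coxeterMatrix, Matrix.of_apply, Fin.mk.injEq]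
  split_ifs with h1 h2 h3 h4 h5 h6
  · subst h1
    rw [pow_one, sgen_sq]
  · subst h2 h3
    exact (sgen_adj n 1 le_rfl hb).1
  · subst h2
    rcases Nat.lt_or_ge b 3 with h | h
    · obtain rfl : b = 1 := by omega
      simp [sgen_sq]
    · rw [max_eq_left (by omega), max_eq_right (by omega)]
      exact sgen_comm n 1 b (by omega)
  · subst h4 h5
    exact (sgen_adj n 1 le_rfl ha).2
  · subst h4
    rcases Nat.lt_or_ge a 3 with h | h
    · obtain rfl : a = 1 := by omega
      simp [sgen_sq]
    · rw [max_eq_right (show 1 ≤ a by omega), max_eq_left (show 0 ≤ 1 by omega)]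
      exact sgen_comm_symm n 1 a (by omega)
  · rw [max_eq_right (by omega), max_eq_right (by omega)]
    rcases h6 with rfl | rfl
    · exact (sgen_adj n a (by omega) hb).1
    · exact (sgen_adj n b (by omega) ha).2
  · rw [max_eq_right (by omega), max_eq_right (by omega)]
    rcases Nat.lt_or_ge a b with h | h
    · exact sgen_comm n a b (by omega)
    · exact sgen_comm_symm n b a (by omega)

/-- The natural homomorphism `Φ : D_n → S_n`, with `Φ(s_{1'}) = s_1` and `Φ(s_i) = s_i` for
`1 ≤ i ≤ n - 1`. The image `Φ(π)` is written `π'`. -/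
def Φ (n : ℕ) : D n →* S n :=
  (coxeterMatrix n).toCoxeterSystem.lift
    ⟨fun a : Fin n ↦ sgen n (max 1 (a : ℕ)), isLiftable_sgen n⟩

/-- `σ = t_{k_1}^{e_1} * ⋯ * t_{k_m}^{e_m}` is the standard OGS canonical form of `σ ∈ S_n`,
with the factors of exponent zero left out. -/
structure IsCanonicalForm {n m : ℕ} (σ : S n) (k e : Fin m → ℕ) : Prop where
  strictMono : StrictMono k
  two_le : ∀ j, 2 ≤ k j
  le : ∀ j, k j ≤ n
  pos : ∀ j, 0 < e j
  lt : ∀ j, e j < k j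
  eq_prod : σ = (List.ofFn fun j ↦ t (sgen n) (k j) ^ e j).prod

/-- `σ ∈ S_n`, with the nonempty standard OGS canonical form given by `k` and `e`, is a
standard OGS elementary element: the sum of the exponents is at most the first index. -/
structure IsElementary {n m : ℕ} (σ : S n) (k e : Fin (m + 1) → ℕ) : Prop
    extends IsCanonicalForm σ k e where
  sum_le : ∑ j, e j ≤ k 0

end TypeD

namespace TypeD

/-! ### Relations among the generators -/

/-! Everything rests on one formula (`length_w_mul`): for `u` in the parabolic subgroup, `ℓ(w_L u)`
is the number of inversions of `u'` plus twice the number of positions before `L` (counted from `0`)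
whose image under `u'` is smaller than that of `L`. Since `Φ(w_L) = 1`, this applies with `u' = π'`.

Upper bound (`length_w_mul_le`): induction on `L` through `w_{L+1} = s_{L+1} w_L s_{L+1}`, starting
from `ℓ(u) ≤ inv(u')` on the parabolic subgroup. Lower bound (`pairSum_le_length`): `D_n` acts on
integer sequences by signed permutations. The number of positive roots made negative is `0` at `1,
2, …, n` and grows by at most one per generator. As `w_L` negates positions `0` and `L`, the count
at `w_L u` can be read off and equals the upper bound.

It remains to count smaller predecessors for elementary `π'`. With `E` the sum of the exponents, the
images increase on the positions below `E` and on those from `E` on. Across the two blocks, the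
comparison of `x < E ≤ y` depends only on the exponents with index at most `y` (`rotations_order`).
The five cases are the resulting values at `y = L`. -/

theorem gen_sq (n i : ℕ) : gen n i * gen n i = 1 := by
  unfold gen
  split_ifs with h
  · exact (coxeterMatrix n).toCoxeterSystem.simple_mul_simple_self ⟨i, h⟩
  · simp

theorem gen_mul_pow {n i j : ℕ} (hi : i < n) (hj : j < n) :
    (gen n i * gen n j) ^ (coxeterMatrix n).M ⟨i, hi⟩ ⟨j, hj⟩ = 1 := by
  rw [gen, gen, dif_pos hi, dif_pos hj]
  exact (coxeterMatrix n).toCoxeterSystem.simple_mul_simple_pow ⟨i, hi⟩ ⟨j, hj⟩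

theorem gen_inv (n i : ℕ) : (gen n i)⁻¹ = gen n i :=
  inv_eq_of_mul_eq_one_right (gen_sq n i)

theorem gen_comm {n i j : ℕ} (hi : 1 ≤ i) (hij : i + 1 < j) :
    gen n i * gen n j = gen n j * gen n i := by
  by_cases hj : j < n
  · have h := gen_mul_pow (show i < n by omega) hj
    have h2 : (coxeterMatrix n).M ⟨i, by omega⟩ ⟨j, hj⟩ = 2 := by
      simp only [coxeterMatrix, Matrix.of_apply, Fin.mk.injEq]
      split_ifs <;> omega
    rw [h2, pow_two] at h
    rw [eq_inv_of_mul_eq_one_left h, mul_inv_rev, gen_inv, gen_inv]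
  · simp [gen, hj]

theorem gen_braid {n i : ℕ} (hi : 1 ≤ i) (hn : i + 1 < n) :
    gen n i * gen n (i + 1) * gen n i = gen n (i + 1) * gen n i * gen n (i + 1) := by
  have h := gen_mul_pow (show i < n by omega) hn
  have h3 : (coxeterMatrix n).M ⟨i, by omega⟩ ⟨i + 1, hn⟩ = 3 := by
    simp only [coxeterMatrix, Matrix.of_apply, Fin.mk.injEq]
    split_ifs <;> first | omega | simp_all
  rw [h3] at h
  have h' : (gen n i * gen n (i + 1) * gen n i) *
      (gen n (i + 1) * gen n i * gen n (i + 1)) = 1 := by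
    rw [← h]
    simp only [pow_succ, pow_zero, one_mul, mul_assoc]
  rw [eq_inv_of_mul_eq_one_left h']
  simp only [mul_inv_rev, gen_inv, mul_assoc]

theorem gen_comm_gen_zero {n : ℕ} (hn : 1 < n) :
    gen n 1 * gen n 0 = gen n 0 * gen n 1 := by
  have h := gen_mul_pow hn (show 0 < n by omega)
  have h2 : (coxeterMatrix n).M ⟨1, hn⟩ ⟨0, by omega⟩ = 2 := by
    simp [coxeterMatrix]
  rw [h2, pow_two] at h
  rw [eq_inv_of_mul_eq_one_left h, mul_inv_rev, gen_inv, gen_inv]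

theorem length_one (n : ℕ) : length (1 : D n) = 0 :=
  (coxeterMatrix n).toCoxeterSystem.length_one

theorem length_gen_mul_le (n i : ℕ) (u : D n) : length (gen n i * u) ≤ length u + 1 := by
  unfold gen
  split_ifs with h
  · refine ((coxeterMatrix n).toCoxeterSystem.length_mul_le _ _).trans ?_
    have := (coxeterMatrix n).toCoxeterSystem.length_simple ⟨i, h⟩
    simp only [CoxeterMatrix.toCoxeterSystem_simple] at this
    rw [this, length, add_comm]
  · simp

theorem Φ_gen {n i : ℕ} (hi : i < n) : Φ n (gen n i) = sgen n (max 1 i) := by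
  rw [gen, dif_pos hi]
  exact (coxeterMatrix n).toCoxeterSystem.lift_apply_simple (isLiftable_sgen n) ⟨i, hi⟩

/-! ### Sums over pairs of positions -/

/-- The sum of `g (a x) (a y)` over all pairs of positions `x < y`. -/
def pairSum {α : Type*} {n : ℕ} (g : α → α → ℕ) (a : Fin n → α) : ℕ :=
  ∑ p : Fin n × Fin n, if p.1 < p.2 then g (a p.1) (a p.2) else 0

/-- Exchanging two adjacent entries only affects the summand of this pair. -/
theorem pairSum_swap {α : Type*} {n : ℕ} (g : α → α → ℕ) (a : Fin n → α) {p q : Fin n}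
    (hpq : (p : ℕ) + 1 = q) :
    pairSum g (a ∘ Equiv.swap p q) + g (a p) (a q) = pairSum g a + g (a q) (a p) := by
  -- Reindexing by the transposition keeps the summands and moves the swap into the order condition,
  -- which changes only at `(p, q)` and `(q, p)` because the positions are adjacent.
  have h1 : pairSum g (a ∘ Equiv.swap p q) = ∑ r : Fin n × Fin n,
      if Equiv.swap p q r.1 < Equiv.swap p q r.2 then g (a r.1) (a r.2) else 0 := by
    unfold pairSum
    rw [← Equiv.sum_comp (Equiv.prodCongr (Equiv.swap p q) (Equiv.swap p q))]
    simp
  have h2 : g (a p) (a q) =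
      ∑ r : Fin n × Fin n, if r = (p, q) then g (a r.1) (a r.2) else 0 := by
    simp
  have h3 : g (a q) (a p) =
      ∑ r : Fin n × Fin n, if r = (q, p) then g (a r.1) (a r.2) else 0 := by
    simp
  rw [h1, h2, h3, pairSum, ← Finset.sum_add_distrib, ← Finset.sum_add_distrib]
  refine Finset.sum_congr rfl fun ⟨x, y⟩ _ ↦ ?_
  have key : ∀ z : Fin n, ((Equiv.swap p q z : Fin n) : ℕ) =
      if (z : ℕ) = p then (q : ℕ) else if (z : ℕ) = q then (p : ℕ) else z := fun z ↦ by
    rw [Equiv.swap_apply_def]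
    simp only [Fin.ext_iff, apply_ite Fin.val]
  simp only [Prod.mk.injEq, Fin.lt_def, Fin.ext_iff, key]
  generalize g (a x) (a y) = c
  split_ifs <;> omega

theorem inversions_eq_pairSum {n : ℕ} (σ : Equiv.Perm (Fin n)) :
    inversions σ = pairSum (fun u v : Fin n ↦ if v < u then 1 else 0) σ := by
  rw [inversions, pairSum, Finset.card_filter]
  refine Finset.sum_congr rfl fun r _ ↦ ?_
  by_cases h : r.1 < r.2 <;> simp [h]

theorem inversions_mul_swap {n : ℕ} (σ : Equiv.Perm (Fin n)) {p q : Fin n}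
    (hpq : (p : ℕ) + 1 = q) (h : σ p < σ q) :
    inversions (σ * Equiv.swap p q) = inversions σ + 1 := by
  have := pairSum_swap (fun u v : Fin n ↦ if v < u then 1 else 0) σ hpq
  rw [inversions_eq_pairSum, inversions_eq_pairSum, Equiv.Perm.coe_mul]
  simpa [h, h.not_gt] using this

theorem sgen_unop {n : ℕ} {p q : Fin n} (hpq : (p : ℕ) + 1 = q) :
    (sgen n q).unop = Equiv.swap p q := by
  rw [sgen, MulOpposite.unop_op, dif_pos ⟨by omega, q.2⟩]
  congr 1
  exact Fin.ext (by simp; omega)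

theorem Φ_gen_mul_unop {n : ℕ} (u : D n) {p q : Fin n} (hpq : (p : ℕ) + 1 = q) :
    (Φ n (gen n q * u)).unop = (Φ n u).unop * Equiv.swap p q := by
  rw [map_mul, MulOpposite.unop_mul, Φ_gen q.2, max_eq_right (by omega), sgen_unop hpq]

theorem inversions_gen_mul_of_lt {n : ℕ} (u : D n) {p q : Fin n} (hpq : (p : ℕ) + 1 = q)
    (h : (Φ n u).unop p < (Φ n u).unop q) :
    inversions (Φ n (gen n q * u)).unop = inversions (Φ n u).unop + 1 := by
  rw [Φ_gen_mul_unop u hpq, inversions_mul_swap _ hpq h]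

theorem inversions_gen_mul_of_gt {n : ℕ} (u : D n) {p q : Fin n} (hpq : (p : ℕ) + 1 = q)
    (h : (Φ n u).unop q < (Φ n u).unop p) :
    inversions (Φ n (gen n q * u)).unop + 1 = inversions (Φ n u).unop := by
  have h1 := inversions_gen_mul_of_lt (gen n q * u) hpq (by
    rw [Φ_gen_mul_unop u hpq]; simpa using h)
  rw [← h1, ← mul_assoc, gen_sq, one_mul]

/-! ### The length on the parabolic subgroup is at most the number of inversions -/

/-- The subgroup generated by `s_1, …, s_{k-1}`. -/
def para (n k : ℕ) : Subgroup (D n) :=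
  Subgroup.closure {g | ∃ i, 1 ≤ i ∧ i < k ∧ g = gen n i}

theorem gen_mem_para {n k i : ℕ} (h1 : 1 ≤ i) (hi : i < k) : gen n i ∈ para n k :=
  Subgroup.subset_closure ⟨i, h1, hi, rfl⟩

/-- The product `s_p s_{p+1} ⋯ s_{p+d-1}`. -/
def ascend (n : ℕ) : ℕ → ℕ → D n
  | _, 0 => 1
  | p, d + 1 => gen n p * ascend n (p + 1) d

theorem gen_mul_ascend_of_lt {n i p : ℕ} (d : ℕ) (hi : 1 ≤ i) (hip : i + 1 < p) :
    gen n i * ascend n p d = ascend n p d * gen n i := by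
  induction d generalizing p with
  | zero => simp [ascend]
  | succ d ih =>
    rw [ascend, ← mul_assoc, gen_comm hi hip, mul_assoc, ih (by omega), mul_assoc]

theorem gen_mul_ascend_of_gt {n i p d : ℕ} (hp : 1 ≤ p) (hpi : p < i) (hid : i < p + d)
    (hi : i < n) : gen n i * ascend n p d = ascend n p d * gen n (i - 1) := by
  induction d generalizing p with
  | zero => omega
  | succ d ih =>
    rcases Nat.lt_or_ge (p + 1) i with h | h
    · rw [ascend, ← mul_assoc, ← gen_comm hp h, mul_assoc, ih (by omega) h (by omega),
        mul_assoc]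
    · obtain rfl : i = p + 1 := by omega
      obtain ⟨d, rfl⟩ : ∃ d', d = d' + 1 := ⟨d - 1, by omega⟩
      rw [ascend, ascend, ← mul_assoc, ← mul_assoc, ← gen_braid hp hi, Nat.add_sub_cancel,
        mul_assoc, gen_mul_ascend_of_lt d hp (by omega)]
      simp only [mul_assoc]

/-- The words `s_p ⋯ s_k` meet every left coset of `para n k`: multiplying one on the left by `s_i`
lengthens it (`i = p - 1`), shortens it (`i = p`), or lets a generator of `para n k` pass to the
right, as `s_i` if `i < p - 1` and as `s_{i-1}` if `i > p`. -/
theorem exists_ascend_mul {n k : ℕ} (hk : k + 1 ≤ n) {u : D n} (hu : u ∈ para n (k + 1)) :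
    ∃ p d v, 1 ≤ p ∧ p + d = k + 1 ∧ v ∈ para n k ∧ u = ascend n p d * v := by
  have step : ∀ i, 1 ≤ i → i < k + 1 → ∀ u : D n,
      (∃ p d v, 1 ≤ p ∧ p + d = k + 1 ∧ v ∈ para n k ∧ u = ascend n p d * v) →
      ∃ p d v, 1 ≤ p ∧ p + d = k + 1 ∧ v ∈ para n k ∧ gen n i * u = ascend n p d * v := by
    rintro i hi1 hik u ⟨p, d, v, hp, hpd, hv, rfl⟩
    rcases lt_trichotomy i p with h | rfl | h
    · rcases Nat.lt_or_ge (i + 1) p with h' | h'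
      · refine ⟨p, d, gen n i * v, hp, hpd, mul_mem (gen_mem_para hi1 (by omega)) hv, ?_⟩
        rw [← mul_assoc, gen_mul_ascend_of_lt d hi1 h', mul_assoc]
      · obtain rfl : p = i + 1 := by omega
        exact ⟨i, d + 1, v, hi1, by omega, hv, by rw [ascend, mul_assoc]⟩
    · obtain ⟨d, rfl⟩ : ∃ d', d = d' + 1 := ⟨d - 1, by omega⟩
      refine ⟨i + 1, d, v, by omega, by omega, hv, ?_⟩
      rw [ascend, ← mul_assoc, ← mul_assoc, gen_sq, one_mul]
    · refine ⟨p, d, gen n (i - 1) * v, hp, hpd,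
        mul_mem (gen_mem_para (by omega) (by omega)) hv, ?_⟩
      rw [← mul_assoc, gen_mul_ascend_of_gt hp h (by omega) (by omega), mul_assoc]
  induction hu using Subgroup.closure_induction_left with
  | one => exact ⟨k + 1, 0, 1, by omega, rfl, one_mem _, by simp [ascend]⟩
  | mul_left x hx y hy ih =>
    obtain ⟨i, h1, h2, rfl⟩ := hx
    exact step i h1 h2 y ih
  | inv_mul_cancel x hx y hy ih =>
    obtain ⟨i, h1, h2, rfl⟩ := hx
    rw [gen_inv]
    exact step i h1 h2 y ih

theorem ascend_mem_para {n k p d : ℕ} (hp : 1 ≤ p) (hpd : p + d ≤ k) :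
    ascend n p d ∈ para n k := by
  induction d generalizing p with
  | zero => exact one_mem _
  | succ d ih => exact mul_mem (gen_mem_para hp (by omega)) (ih (by omega) (by omega))

theorem Φ_apply_of_mem_para {n k : ℕ} {u : D n} (hu : u ∈ para n k) (x : Fin n)
    (hx : k ≤ x) : (Φ n u).unop x = x := by
  have : para n k ≤ (MulAction.stabilizer (Equiv.Perm (Fin n)) x).op.comap (Φ n) := by
    rw [para, Subgroup.closure_le]
    rintro _ ⟨i, h1, h2, rfl⟩
    simp only [SetLike.mem_coe, Subgroup.mem_comap, Subgroup.mem_op, MulAction.mem_stabilizer_iff,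
      Equiv.Perm.smul_def]
    have hs : ((⟨i - 1, by omega⟩ : Fin n) : ℕ) + 1 = ((⟨i, by omega⟩ : Fin n) : ℕ) := by
      simp; omega
    rw [Φ_gen (by omega), max_eq_right h1]
    erw [sgen_unop hs]
    apply Equiv.swap_apply_of_ne_of_ne <;> rw [Ne, Fin.ext_iff] <;> simp <;> omega
  exact this hu

theorem length_le_inversions_of_mem_para {n k : ℕ} (hk : k ≤ n) {u : D n}
    (hu : u ∈ para n k) : length u ≤ inversions (Φ n u).unop := by
  induction k generalizing u with
  | zero =>
    have : para n 0 = ⊥ := by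
      rw [para, Subgroup.closure_eq_bot_iff]
      rintro x ⟨i, h1, h2, -⟩
      omega
    rw [this, Subgroup.mem_bot] at hu
    simp [hu, length_one]
  | succ k ih =>
    obtain ⟨p, d, v, hp, hpd, hv, rfl⟩ := exists_ascend_mul hk hu
    have hv' := ih (by omega) hv
    -- The induction also tracks the value `k`: each letter of the ascending word moves it one
    -- position to the left.
    suffices H : length (ascend n p d * v) ≤ inversions (Φ n (ascend n p d * v)).unop ∧
        ∀ x : Fin n, (x : ℕ) + 1 = p → ((Φ n (ascend n p d * v)).unop x : ℕ) = k from H.1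
    clear hu
    induction d generalizing p with
    | zero =>
      simp only [ascend, one_mul]
      refine ⟨hv', fun x hx ↦ ?_⟩
      rw [Φ_apply_of_mem_para hv x (by omega)]
      omega
    | succ d ihd =>
      obtain ⟨h1, h2⟩ := ihd (p + 1) (by omega) (by omega)
      set y := ascend n (p + 1) d * v with hy
      have hmem : y ∈ para n (k + 1) :=
        mul_mem (ascend_mem_para (by omega) (by omega))
          (Subgroup.closure_mono (by
            rintro _ ⟨i, h1, h2, rfl⟩
            exact ⟨i, h1, by omega, rfl⟩) hv)
      have hq : ((⟨p - 1, by omega⟩ : Fin n) : ℕ) + 1 = ((⟨p, by omega⟩ : Fin n) : ℕ) := by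
        simp; omega
      have h2' := h2 ⟨p, by omega⟩ rfl
      -- Values above `k` are fixed points, so the left neighbour of the value `k` is smaller and
      -- the new letter creates an inversion.
      have hlt : (Φ n y).unop ⟨p - 1, by omega⟩ < (Φ n y).unop ⟨p, by omega⟩ := by
        by_contra hcon
        set z := (Φ n y).unop ⟨p - 1, by omega⟩ with hz
        have hne : (z : ℕ) ≠ k := by
          intro h
          have := (Φ n y).unop.injective (Fin.ext (h.trans h2'.symm))
          rw [Fin.ext_iff] at this
          simp at this
          omega
        have hzk : k + 1 ≤ (z : ℕ) := by
          rw [Fin.lt_def] at hcon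
          omega
        have := (Φ n y).unop.injective
          ((Φ_apply_of_mem_para hmem z hzk).trans hz)
        rw [Fin.ext_iff] at this
        simp at this
        omega
      have hinv := inversions_gen_mul_of_lt y hq hlt
      have hlen := length_gen_mul_le n p y
      rw [ascend, mul_assoc, ← hy]
      refine ⟨by simp only at hinv; omega, fun x hx ↦ ?_⟩
      have hΦ := Φ_gen_mul_unop y hq
      simp only at hΦ
      rw [hΦ]
      have hx' : x = ⟨p - 1, by omega⟩ := Fin.ext (by simp; omega)
      simp [hx', h2']

/-! ### The order of the values of elementary elements -/

/-- The action of `t_k ^ e` on the position `x`, both counted from `0`. -/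
def rotate (k e x : ℕ) : ℕ :=
  if x < e then x + k - e else if x < k then x - e else x

/-- The composite of the rotations `t_k ^ e`, the first pair of the list acting first. -/
def rotations : List (ℕ × ℕ) → ℕ → ℕ
  | [], x => x
  | p :: l, x => rotations l (rotate p.1 p.2 x)

/-- The sum of the exponents. -/
def expSum (l : List (ℕ × ℕ)) : ℕ := (l.map Prod.snd).sum

/-- The sum of the exponents of those factors whose index is at most `y`. -/
def expSumLE (y : ℕ) (l : List (ℕ × ℕ)) : ℕ :=
  (l.map fun p ↦ if p.1 ≤ y then p.2 else 0).sum

/-- The list form of the conditions on a standard OGS elementary element. -/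
inductive Elementary : List (ℕ × ℕ) → Prop
  | nil : Elementary []
  | cons {k e : ℕ} {l : List (ℕ × ℕ)} (hl : Elementary l) (hk : ∀ p ∈ l, k < p.1)
      (he : e < k) (hs : e + expSum l ≤ k) : Elementary ((k, e) :: l)

theorem expSum_cons (k e : ℕ) (l : List (ℕ × ℕ)) : expSum ((k, e) :: l) = e + expSum l := by
  simp [expSum]

theorem expSumLE_cons (y k e : ℕ) (l : List (ℕ × ℕ)) :
    expSumLE y ((k, e) :: l) = (if k ≤ y then e else 0) + expSumLE y l := by
  simp [expSumLE]

theorem expSumLE_eq_zero {y : ℕ} {l : List (ℕ × ℕ)} (h : ∀ p ∈ l, y < p.1) :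
    expSumLE y l = 0 := by
  induction l with
  | nil => rfl
  | cons p l ih =>
    obtain ⟨k, e⟩ := p
    have h1 : y < k := h (k, e) (by simp)
    rw [expSumLE_cons, ih fun q hq ↦ h q (by simp [hq]), if_neg (by omega)]

/-- Let `E'` be the exponent sum of the tail, so `E' ≤ k - e`. The first rotation sends `[0, e)` to
`[k - e, k)`, beyond `E'`; it sends `[e, e + E')` onto `[0, E')` and `[e + E', k)` onto `[E', k -
e)`, and fixes the rest. Hence the blocks of the tail determine those of the whole list. For `y < k`
no index of the tail is at most `y`. -/
theorem rotations_order {l : List (ℕ × ℕ)} (hl : Elementary l) :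
    (∀ x y, x < y → y < expSum l → rotations l x < rotations l y) ∧
    (∀ x y, x < y → expSum l ≤ x → rotations l x < rotations l y) ∧
    (∀ x y, x < expSum l → expSum l ≤ y →
      (x < expSumLE y l → rotations l x < rotations l y) ∧
      (expSumLE y l ≤ x → rotations l y < rotations l x)) := by
  induction hl with
  | nil => simp [expSum, rotations]
  | @cons k e l hl hk he hs ih =>
    obtain ⟨ih1, ih2, ih3⟩ := ih
    have key : ∀ y, y < k → expSumLE y l = 0 := fun y hy ↦
      expSumLE_eq_zero fun p hp ↦ hy.trans (hk p hp)
    simp only [expSum_cons, expSumLE_cons, rotations]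
    have r1 : ∀ x, x < e → rotate k e x = x + k - e := fun x hx ↦ by simp [rotate, hx]
    have r2 : ∀ x, e ≤ x → x < k → rotate k e x = x - e := fun x hx hx' ↦ by
      simp [rotate, hx', Nat.not_lt.2 hx]
    have r3 : ∀ x, k ≤ x → rotate k e x = x := fun x hx ↦ by
      simp [rotate, Nat.not_lt.2 hx, show ¬ x < e by omega]
    refine ⟨fun x y hxy hy ↦ ?_, fun x y hxy hx ↦ ?_, fun x y hx hy ↦ ?_⟩
    · rcases lt_or_ge y e with h | h
      · rw [r1 x (by omega), r1 y h]
        exact ih2 _ _ (by omega) (by omega)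
      · rw [r2 y h (by omega)]
        rcases lt_or_ge x e with h' | h'
        · rw [r1 x h']
          exact (ih3 (y - e) (x + k - e) (by omega) (by omega)).2
            (by rw [key _ (by omega)]; omega)
        · rw [r2 x h' (by omega)]
          exact ih1 _ _ (by omega) (by omega)
    · rcases lt_or_ge y k with h | h
      · rw [r2 x (by omega) (by omega), r2 y (by omega) h]
        exact ih2 _ _ (by omega) (by omega)
      · rw [r3 y h]
        rcases lt_or_ge x k with h' | h'
        · rw [r2 x (by omega) h']
          exact ih2 _ _ (by omega) (by omega)
        · rw [r3 x h']
          exact ih2 _ _ hxy (by omega)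
    · rcases lt_or_ge y k with h | h
      · rw [if_neg (by omega), key y h, r2 y (by omega) h]
        refine ⟨by omega, fun _ ↦ ?_⟩
        rcases lt_or_ge x e with h' | h'
        · rw [r1 x h']
          exact ih2 _ _ (by omega) (by omega)
        · rw [r2 x h' (by omega)]
          exact (ih3 _ _ (by omega) (by omega)).2 (by rw [key _ (by omega)]; omega)
      · rw [if_pos h, r3 y h]
        rcases lt_or_ge x e with h' | h'
        · rw [r1 x h']
          exact ⟨fun _ ↦ ih2 _ _ (by omega) (by omega), by omega⟩
        · rw [r2 x h' (by omega)]
          exact ⟨fun h ↦ (ih3 _ _ (by omega) (by omega)).1 (by omega),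
            fun h ↦ (ih3 _ _ (by omega) (by omega)).2 (by omega)⟩

theorem expSumLE_le (y : ℕ) (l : List (ℕ × ℕ)) : expSumLE y l ≤ expSum l := by
  induction l with
  | nil => rfl
  | cons p l ih =>
    obtain ⟨k, e⟩ := p
    rw [expSumLE_cons, expSum_cons]
    split_ifs <;> omega

/-- The number of positions before `y` with a smaller image under the rotations. -/
theorem card_rotations_lt {l : List (ℕ × ℕ)} (hl : Elementary l) (y : ℕ) :
    ((Finset.range y).filter fun x ↦ rotations l x < rotations l y).card =
      if y < expSum l then y else y - expSum l + expSumLE y l := by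
  obtain ⟨h1, h2, h3⟩ := rotations_order hl
  have hle := expSumLE_le y l
  split_ifs with h
  · rw [Finset.filter_true_of_mem, Finset.card_range]
    exact fun x hx ↦ h1 x y (Finset.mem_range.1 hx) h
  · have : (Finset.range y).filter (fun x ↦ rotations l x < rotations l y) =
        Finset.range (expSumLE y l) ∪ Finset.Ico (expSum l) y := by
      ext x
      simp only [Finset.mem_filter, Finset.mem_range, Finset.mem_union, Finset.mem_Ico]
      constructor
      · rintro ⟨hx, hxy⟩
        by_contra hc
        have := (h3 x y (by omega) (by omega)).2 (by omega)
        omega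
      · rintro (hx | hx)
        · exact ⟨by omega, (h3 x y (by omega) (by omega)).1 hx⟩
        · exact ⟨hx.2, h2 x y hx.2 hx.1⟩
    rw [this, Finset.card_union_of_disjoint, Finset.card_range, Nat.card_Ico, add_comm]
    rw [Finset.disjoint_left]
    intro x hx hx'
    simp only [Finset.mem_range, Finset.mem_Ico] at hx hx'
    omega

/-- Bounding the sum by every index, not only the first, lets the hypothesis pass to the tail. -/
theorem elementary_of_pairwise {l : List (ℕ × ℕ)} (hl : l.Pairwise fun p q ↦ p.1 < q.1)
    (hlt : ∀ p ∈ l, p.2 < p.1) (hs : ∀ p ∈ l, expSum l ≤ p.1) : Elementary l := by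
  induction l with
  | nil => exact .nil
  | cons p l ih =>
    obtain ⟨k, e⟩ := p
    rw [List.pairwise_cons] at hl
    simp only [List.mem_cons, forall_eq_or_imp, expSum_cons] at hlt hs
    exact .cons (ih hl.2 hlt.2 fun q hq ↦ by have := hs.2 q hq; omega) hl.1 hlt.1 hs.1

theorem expSum_ofFn {m : ℕ} (k e : Fin m → ℕ) :
    expSum (List.ofFn fun j ↦ (k j, e j)) = ∑ j, e j := by
  simp [expSum, List.map_ofFn, List.sum_ofFn]

theorem expSumLE_ofFn {m : ℕ} (y : ℕ) (k e : Fin m → ℕ) :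
    expSumLE y (List.ofFn fun j ↦ (k j, e j)) = ∑ j, if k j ≤ y then e j else 0 := by
  simp [expSumLE, List.map_ofFn, List.sum_ofFn]

/-! ### Powers of `t_k` as rotations of positions -/

theorem sgen_apply {n i : ℕ} (h1 : 1 ≤ i) (hi : i < n) (x : Fin n) :
    (((sgen n i).unop x : Fin n) : ℕ) =
      if (x : ℕ) = i - 1 then i else if (x : ℕ) = i then i - 1 else x := by
  rw [sgen, MulOpposite.unop_op, dif_pos ⟨h1, hi⟩, Equiv.swap_apply_def]
  simp only [Fin.ext_iff, apply_ite Fin.val]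

theorem t_apply {n k : ℕ} (h1 : 1 ≤ k) (hk : k ≤ n) (x : Fin n) :
    (((t (sgen n) k).unop x : Fin n) : ℕ) = rotate k 1 x := by
  induction k, h1 using Nat.le_induction with
  | base => simp [t, rotate]; omega
  | succ k h1 ih =>
    have : t (sgen n) (k + 1) = t (sgen n) k * sgen n k := by
      obtain ⟨k, rfl⟩ := Nat.exists_eq_add_of_le' h1
      simp [t, List.range_succ]
    rw [this, MulOpposite.unop_mul, Equiv.Perm.mul_apply, sgen_apply h1 hk, ih (by omega)]
    unfold rotate
    split_ifs <;> omega

theorem t_pow_apply {n k e : ℕ} (hk : k ≤ n) (he : e < k) (x : Fin n) :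
    (((t (sgen n) k ^ e).unop x : Fin n) : ℕ) = rotate k e x := by
  induction e with
  | zero => simp [rotate]
  | succ e ih =>
    rw [pow_succ, MulOpposite.unop_mul, Equiv.Perm.mul_apply, t_apply (by omega) hk,
      ih (by omega)]
    unfold rotate
    split_ifs <;> omega

theorem prod_t_pow_apply {n : ℕ} {l : List (ℕ × ℕ)} (hl : ∀ p ∈ l, p.1 ≤ n ∧ p.2 < p.1)
    (x : Fin n) :
    ((((l.map fun p ↦ t (sgen n) p.1 ^ p.2).prod).unop x : Fin n) : ℕ) = rotations l x := by
  induction l generalizing x with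
  | nil => simp [rotations]
  | cons p l ih =>
    simp only [List.mem_cons, forall_eq_or_imp] at hl
    rw [List.map_cons, List.prod_cons, MulOpposite.unop_mul, Equiv.Perm.mul_apply, ih hl.2,
      t_pow_apply hl.1.1 hl.1.2, rotations]

theorem IsElementary.elementary {n m : ℕ} {σ : S n} {k e : Fin (m + 1) → ℕ}
    (h : IsElementary σ k e) : Elementary (List.ofFn fun j ↦ (k j, e j)) := by
  apply elementary_of_pairwise
  · rw [List.pairwise_ofFn]
    exact fun i j hij ↦ h.strictMono hij
  · rw [List.forall_mem_ofFn_iff]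
    exact h.lt
  · rw [expSum_ofFn, List.forall_mem_ofFn_iff]
    exact fun j ↦ h.sum_le.trans (h.strictMono.monotone (Fin.zero_le j))

theorem IsCanonicalForm.apply {n m : ℕ} {σ : S n} {k e : Fin m → ℕ}
    (h : IsCanonicalForm σ k e) (x : Fin n) :
    ((σ.unop x : Fin n) : ℕ) = rotations (List.ofFn fun j ↦ (k j, e j)) x := by
  rw [← prod_t_pow_apply (n := n), h.eq_prod, List.map_ofFn]
  · rfl
  · rw [List.forall_mem_ofFn_iff]
    exact fun j ↦ ⟨h.le j, h.lt j⟩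

/-- The number of positions before `y` whose image under `σ` is smaller than that of `y`. -/
def smallerBefore {n : ℕ} (σ : Equiv.Perm (Fin n)) (y : Fin n) : ℕ :=
  (Finset.univ.filter fun x ↦ x < y ∧ σ x < σ y).card

theorem IsElementary.smallerBefore_eq {n m : ℕ} {σ : S n} {k e : Fin (m + 1) → ℕ}
    (h : IsElementary σ k e) (y : Fin n) :
    smallerBefore σ.unop y =
      if (y : ℕ) < ∑ j, e j then (y : ℕ)
      else y - ∑ j, e j + ∑ j, if k j ≤ y then e j else 0 := by
  rw [← expSum_ofFn k, ← expSumLE_ofFn, ← card_rotations_lt h.elementary, smallerBefore]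
  refine Finset.card_bij (fun x _ ↦ (x : ℕ)) ?_ (fun _ _ _ _ ↦ Fin.ext) ?_
  · intro x hx
    simp only [Finset.mem_filter, Finset.mem_univ, true_and, Fin.lt_def, h.apply] at hx
    simpa only [Finset.mem_filter, Finset.mem_range] using hx
  · intro x hx
    simp only [Finset.mem_filter, Finset.mem_range] at hx
    exact ⟨⟨x, hx.1.trans y.2⟩, by
      simpa only [Finset.mem_filter, Finset.mem_univ, true_and, Fin.lt_def, h.apply] using hx, rfl⟩

/-- An elementary element whose exponent sum is smaller than the first index has its only
descent at the exponent sum. -/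
theorem IsElementary.maj_eq {n m : ℕ} {σ : S n} {k e : Fin (m + 1) → ℕ}
    (h : IsElementary σ k e) (hlt : ∑ j, e j < k 0) : maj σ.unop = ∑ j, e j := by
  obtain ⟨h1, h2, h3⟩ := rotations_order h.elementary
  have hpos : 0 < ∑ j, e j := Finset.sum_pos (fun j _ ↦ h.pos j) Finset.univ_nonempty
  have hn := h.le 0
  have hzero : expSumLE (∑ j, e j) (List.ofFn fun j ↦ (k j, e j)) = 0 := by
    apply expSumLE_eq_zero
    rw [List.forall_mem_ofFn_iff]
    exact fun j ↦ hlt.trans_le (h.strictMono.monotone (Fin.zero_le j))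
  rw [expSum_ofFn] at h1 h2 h3
  have key : ∀ i ∈ Finset.Ico 1 n,
      (∃ hi : i < n, σ.unop ⟨i, hi⟩ < σ.unop ⟨i - 1, by omega⟩) ↔ i = ∑ j, e j := by
    intro i hi
    rw [Finset.mem_Ico] at hi
    simp only [Fin.lt_def, h.apply, hi.2, exists_true_left]
    rcases lt_trichotomy i (∑ j, e j) with hc | hc | hc
    · have := h1 (i - 1) i (by omega) hc
      omega
    -- No index is at most the exponent sum, so every position of the first block has a larger image
    -- than this one.
    · have := (h3 (i - 1) i (by omega) hc.ge).2 (by rw [hc, hzero]; omega)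
      exact iff_of_true this hc
    · have := h2 (i - 1) i (by omega) (by omega)
      omega
  rw [maj, Finset.sum_congr rfl fun i hi ↦ if_congr (key i hi) rfl rfl,
    Finset.sum_ite_eq' _ _ _]
  rw [if_pos (Finset.mem_Ico.2 ⟨hpos, by omega⟩)]

/-! ### The upper bound for the length of `w_L * u` -/

theorem w_one (n : ℕ) : w n 1 = gen n 1 * gen n 0 := by
  simp [w]

theorem w_succ {n L : ℕ} (hL : 1 ≤ L) : w n (L + 1) = gen n (L + 1) * w n L * gen n (L + 1) := by
  obtain ⟨L, rfl⟩ := Nat.exists_eq_add_of_le' hL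
  have h1 : ((List.range (L + 1 + 1)).map fun j ↦ gen n (L + 1 + 1 - j)).prod =
      gen n (L + 1 + 1) * ((List.range (L + 1)).map fun j ↦ gen n (L + 1 - j)).prod := by
    rw [List.range_succ_eq_map, List.map_cons, List.prod_cons, List.map_map]
    congr 3
    funext j
    simp only [Function.comp_apply]
    congr 1
    omega
  have h2 : ((List.range (L + 1)).map fun j ↦ gen n (j + 2)).prod =
      ((List.range L).map fun j ↦ gen n (j + 2)).prod * gen n (L + 1 + 1) := by
    rw [List.range_succ, List.map_append, List.prod_append, List.map_singleton,
      List.prod_singleton]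
  simp only [w, Nat.add_sub_cancel]
  rw [h1, h2]
  simp only [mul_assoc]

/-- Moving the entry at `q` one place left only removes the entry at `p` from its predecessors. -/
theorem smallerBefore_eq_mul_swap {n : ℕ} (σ : Equiv.Perm (Fin n)) {p q : Fin n}
    (hpq : (p : ℕ) + 1 = q) :
    smallerBefore σ q =
      smallerBefore (σ * Equiv.swap p q) p + if σ p < σ q then 1 else 0 := by
  have hswap : ∀ x, x < p → Equiv.swap p q x = x := fun x hx ↦ by
    apply Equiv.swap_apply_of_ne_of_ne <;> rw [Ne, Fin.ext_iff] <;> rw [Fin.lt_def] at hx <;> omega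
  have h : ∀ x, ((if x < q ∧ σ x < σ q then 1 else 0) : ℕ) =
      (if x < p ∧ (σ * Equiv.swap p q) x < (σ * Equiv.swap p q) p then 1 else 0) +
        if x = p then (if σ p < σ q then 1 else 0) else 0 := by
    intro x
    rw [Equiv.Perm.mul_apply, Equiv.Perm.mul_apply, Equiv.swap_apply_left]
    rcases lt_trichotomy x p with hx | rfl | hx
    · rw [hswap x hx]
      simp [hx, hx.ne, hx.trans (show p < q by rw [Fin.lt_def]; omega)]
    · simp [show x < q by rw [Fin.lt_def]; omega]
    · simp [hx.not_gt, hx.ne', show ¬ x < q by rw [Fin.lt_def] at *; omega]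
  rw [smallerBefore, smallerBefore, Finset.card_filter, Finset.card_filter,
    Finset.sum_congr rfl fun x _ ↦ h x, Finset.sum_add_distrib]
  simp

theorem length_w_mul_le {n L : ℕ} (hL : 1 ≤ L) (hLn : L < n) {u : D n} (hu : u ∈ parabolic n) :
    length (w n L * u) ≤
      inversions (Φ n u).unop + 2 * smallerBefore (Φ n u).unop ⟨L, hLn⟩ := by
  have hgen : ∀ i, 1 ≤ i → i < n → ∀ u ∈ parabolic n, gen n i * u ∈ parabolic n :=
    fun i h1 h2 u hu ↦ mul_mem (Subgroup.subset_closure ⟨i, h1, h2, rfl⟩) hu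
  -- At an ascent the inversions grow by one and the smaller predecessors drop by one; at a descent
  -- the inversions drop by one and the predecessors stay. The `+ 1` pays for the outer letter of
  -- `w_L`.
  have key : ∀ (p q : Fin n), (p : ℕ) + 1 = q → ∀ u : D n,
      inversions (Φ n (gen n q * u)).unop + 1 + 2 * smallerBefore (Φ n (gen n q * u)).unop p =
        inversions (Φ n u).unop + 2 * smallerBefore (Φ n u).unop q := by
    intro p q hpq u
    rw [smallerBefore_eq_mul_swap _ hpq]
    rcases lt_trichotomy ((Φ n u).unop p) ((Φ n u).unop q) with h | h | h
    · rw [inversions_gen_mul_of_lt u hpq h, if_pos h, Φ_gen_mul_unop u hpq]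
      ring
    · have := (Φ n u).unop.injective h
      rw [this] at hpq
      omega
    · rw [← inversions_gen_mul_of_gt u hpq h, if_neg h.not_gt, Φ_gen_mul_unop u hpq]
      ring
  induction L, hL using Nat.le_induction generalizing u with
  | base =>
    have h := key ⟨0, by omega⟩ ⟨1, hLn⟩ rfl u
    have h0 : smallerBefore (Φ n (gen n 1 * u)).unop ⟨0, by omega⟩ = 0 := by
      rw [smallerBefore, Finset.card_eq_zero, Finset.filter_eq_empty_iff]
      exact fun x _ h ↦ absurd (Fin.lt_def.1 h.1) (Nat.not_lt_zero _)
    -- With `s_{1'}` in front, the remaining factor `s_1 u` is parabolic.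
    rw [w_one, gen_comm_gen_zero hLn, mul_assoc]
    have h1 := length_gen_mul_le n 0 (gen n 1 * u)
    have h2 := length_le_inversions_of_mem_para le_rfl (hgen 1 le_rfl hLn u hu)
    simp only at h
    omega
  | succ L hL ih =>
    have h := key ⟨L, by omega⟩ ⟨L + 1, hLn⟩ rfl u
    have h1 := ih (by omega) (hgen (L + 1) (by omega) hLn u hu)
    have h2 := length_gen_mul_le n (L + 1) (w n L * (gen n (L + 1) * u))
    rw [w_succ hL, mul_assoc, mul_assoc]
    simp only at h
    omega

/-! ### The action of `D_n` by signed permutations -/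

/-- The action of `S_n` on sequences by permuting the positions. -/
def permHom (n : ℕ) : S n →* Function.End (Fin n → ℤ) where
  toFun σ := fun a ↦ a ∘ σ.unop
  map_one' := rfl
  map_mul' _ _ := rfl

/-- Changing the sign of the entry in position `p`, counted from `0`. -/
def negAt (n p : ℕ) : Function.End (Fin n → ℤ) :=
  fun a x ↦ if (x : ℕ) = p then -a x else a x

theorem end_mul_apply {n : ℕ} (f g : Function.End (Fin n → ℤ)) (a : Fin n → ℤ) :
    (f * g) a = f (g a) := rfl

theorem negAt_apply {n : ℕ} (p : ℕ) (a : Fin n → ℤ) (x : Fin n) :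
    negAt n p a x = if (x : ℕ) = p then -a x else a x := rfl

theorem permHom_apply {n : ℕ} (σ : S n) (a : Fin n → ℤ) (x : Fin n) :
    permHom n σ a x = a (σ.unop x) := rfl

theorem negAt_mul_self (n p : ℕ) : negAt n p * negAt n p = 1 := by
  funext a x
  rw [end_mul_apply, negAt_apply, negAt_apply]
  split_ifs
  · exact neg_neg _
  · rfl

theorem negAt_comm (n p q : ℕ) : negAt n p * negAt n q = negAt n q * negAt n p := by
  funext a x
  simp only [end_mul_apply, negAt_apply]
  split_ifs <;> rfl

theorem permHom_sgen_sq (n i : ℕ) : permHom n (sgen n i) * permHom n (sgen n i) = 1 := by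
  rw [← map_mul, sgen_sq, map_one]

theorem negAt_comm_sgen {n p i : ℕ} (hi : 1 ≤ i) (hin : i < n) (hp : p + 1 < i) :
    negAt n p * permHom n (sgen n i) = permHom n (sgen n i) * negAt n p := by
  funext a x
  have := sgen_apply hi hin x
  simp only [end_mul_apply, negAt_apply, permHom_apply]
  refine if_congr ?_ rfl rfl
  rw [this]
  split_ifs <;> omega

theorem sgen_mul_negAt {n p : ℕ} (hp : p + 1 < n) :
    permHom n (sgen n (p + 1)) * negAt n p =
      negAt n (p + 1) * permHom n (sgen n (p + 1)) := by
  funext a x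
  have := sgen_apply (by omega) hp x
  simp only [end_mul_apply, negAt_apply, permHom_apply]
  refine if_congr ?_ rfl rfl
  rw [this]
  split_ifs <;> omega

/-- The images of the generators under the signed permutation action. -/
def signedGen (n i : ℕ) : Function.End (Fin n → ℤ) :=
  -- The conjugate exchanges the first two entries and negates both.
  if i = 0 then negAt n 0 * permHom n (sgen n 1) * negAt n 0 else permHom n (sgen n i)

theorem signedGen_sq (n i : ℕ) : signedGen n i * signedGen n i = 1 := by
  unfold signedGen
  split_ifs
  · calc _ = negAt n 0 * permHom n (sgen n 1) * (negAt n 0 * negAt n 0) *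
          permHom n (sgen n 1) * negAt n 0 := by simp only [mul_assoc]
      _ = negAt n 0 * (permHom n (sgen n 1) * permHom n (sgen n 1)) * negAt n 0 := by
        rw [negAt_mul_self, mul_one]; simp only [mul_assoc]
      _ = 1 := by rw [permHom_sgen_sq, mul_one, negAt_mul_self]
  · exact permHom_sgen_sq n i

/-- The sign change at position `0` commutes with `s_i` for `i ≥ 2`, so the product is a conjugate
of the image of `s_1 s_i`. -/
theorem signedGen_zero_mul_pow {n i k : ℕ} (hi : 2 ≤ i) (hin : i < n)
    (h : (sgen n 1 * sgen n i) ^ k = 1) : (signedGen n 0 * signedGen n i) ^ k = 1 := by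
  have hconj : signedGen n 0 * signedGen n i =
      negAt n 0 * permHom n (sgen n 1 * sgen n i) * negAt n 0 := by
    rw [signedGen, signedGen, if_pos rfl, if_neg (by omega), mul_assoc,
      negAt_comm_sgen (by omega) hin (by omega), map_mul]
    simp only [mul_assoc]
  have hpow : ∀ x : Function.End (Fin n → ℤ), ∀ j : ℕ,
      (negAt n 0 * x * negAt n 0) ^ j = negAt n 0 * x ^ j * negAt n 0 := by
    intro x j
    induction j with
    | zero => simp [negAt_mul_self]
    | succ j ih =>
      calc _ = negAt n 0 * x ^ j * (negAt n 0 * negAt n 0) * x * negAt n 0 := by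
            rw [pow_succ, ih]; simp only [mul_assoc]
        _ = _ := by rw [negAt_mul_self, mul_one, pow_succ]; simp only [mul_assoc]
  rw [hconj, hpow, ← map_pow, h, map_one, mul_one, negAt_mul_self]

theorem signedGen_zero_mul_one {n : ℕ} (hn : 1 < n) :
    signedGen n 0 * signedGen n 1 = negAt n 0 * negAt n 1 := by
  rw [signedGen, signedGen, if_pos rfl, if_neg one_ne_zero, mul_assoc (negAt n 0),
    sgen_mul_negAt hn, mul_assoc, mul_assoc, permHom_sgen_sq, mul_one]

theorem signedGen_zero_mul_one_sq {n : ℕ} (hn : 1 < n) :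
    (signedGen n 0 * signedGen n 1) ^ 2 = 1 := by
  rw [signedGen_zero_mul_one hn, pow_two]
  calc _ = negAt n 0 * (negAt n 1 * negAt n 0) * negAt n 1 := by simp only [mul_assoc]
    _ = (negAt n 0 * negAt n 0) * (negAt n 1 * negAt n 1) := by
      rw [negAt_comm n 1 0]; simp only [mul_assoc]
    _ = 1 := by rw [negAt_mul_self, negAt_mul_self, mul_one]

theorem isLiftable_signedGen (n : ℕ) :
    (coxeterMatrix n).IsLiftable fun a : Fin n ↦ signedGen n a := by
  have symm : ∀ x y : Function.End (Fin n → ℤ), ∀ k : ℕ, y * y = 1 →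
      (x * y) ^ k = 1 → (y * x) ^ k = 1 := by
    intro x y k hy h
    have h1 : (y * x) ^ k * y = y := by rw [mul_pow_mul, h, mul_one]
    calc (y * x) ^ k = (y * x) ^ k * y * y := by rw [mul_assoc, hy, mul_one]
      _ = 1 := by rw [h1, hy]
  have zero_left : ∀ b : Fin n, 0 < (b : ℕ) → ∀ h0 : 0 < n,
      (signedGen n 0 * signedGen n b) ^ (coxeterMatrix n).M ⟨0, h0⟩ b = 1 := by
    intro b hb h0
    rcases Nat.lt_or_ge b 2 with h | h
    · have hb1 : (b : ℕ) = 1 := by omega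
      have : (coxeterMatrix n).M ⟨0, h0⟩ b = 2 := by
        simp [coxeterMatrix, Fin.ext_iff, hb1]
      rw [this, hb1]
      exact signedGen_zero_mul_one_sq (by omega)
    · have h1 := isLiftable_sgen n ⟨1, by omega⟩ b
      have : (coxeterMatrix n).M ⟨0, h0⟩ b = (coxeterMatrix n).M ⟨1, by omega⟩ b := by
        simp only [coxeterMatrix, Matrix.of_apply, Fin.ext_iff]
        split_ifs <;> omega
      rw [this]
      simp only at h1
      rw [max_self, max_eq_right (by omega)] at h1
      exact signedGen_zero_mul_pow h b.2 h1
  intro a b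
  rcases Nat.eq_zero_or_pos a with ha | ha <;> rcases Nat.eq_zero_or_pos b with hb | hb
  · obtain rfl : a = b := Fin.ext (by omega)
    rw [(coxeterMatrix n).diagonal, pow_one, signedGen_sq]
  · have h := zero_left b hb a.pos
    rwa [show (⟨0, a.pos⟩ : Fin n) = a from Fin.ext ha.symm, ← ha] at h
  · have h := zero_left a ha a.pos
    rw [show (⟨0, a.pos⟩ : Fin n) = b from Fin.ext hb.symm, ← hb,
      (coxeterMatrix n).symmetric] at h
    exact symm _ _ _ (signedGen_sq _ _) h
  · have h := isLiftable_sgen n a b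
    have ha' : max 1 (a : ℕ) = a := max_eq_right ha
    have hb' : max 1 (b : ℕ) = b := max_eq_right hb
    simp only [ha', hb'] at h
    have h' := congrArg (permHom n) h
    rw [map_pow, map_mul, map_one] at h'
    simpa only [signedGen, if_neg ha.ne', if_neg hb.ne'] using h'

/-- The action of `D_n` on integer sequences by signed permutations of the positions. -/
def signedHom (n : ℕ) : D n →* Function.End (Fin n → ℤ) :=
  (coxeterMatrix n).toCoxeterSystem.lift ⟨fun a : Fin n ↦ signedGen n a, isLiftable_signedGen n⟩

theorem signedHom_gen {n i : ℕ} (hi : i < n) : signedHom n (gen n i) = signedGen n i := by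
  rw [gen, dif_pos hi]
  exact (coxeterMatrix n).toCoxeterSystem.lift_apply_simple (isLiftable_signedGen n) ⟨i, hi⟩

theorem signedHom_of_mem_parabolic {n : ℕ} {u : D n} (hu : u ∈ parabolic n) :
    signedHom n u = permHom n (Φ n u) := by
  have hgen : ∀ i, 1 ≤ i → i < n → signedHom n (gen n i) = permHom n (Φ n (gen n i)) := by
    intro i h1 h2
    rw [signedHom_gen h2, Φ_gen h2, max_eq_right h1, signedGen, if_neg (by omega)]
  induction hu using Subgroup.closure_induction_left with
  | one => simp
  | mul_left x hx y hy ih =>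
    obtain ⟨i, h1, h2, rfl⟩ := hx
    rw [map_mul, map_mul, map_mul, ih, hgen i h1 h2]
  | inv_mul_cancel x hx y hy ih =>
    obtain ⟨i, h1, h2, rfl⟩ := hx
    rw [gen_inv, map_mul, map_mul, map_mul, ih, hgen i h1 h2]

/-- Conjugation by `s_{L+1}` carries the sign change at `L` to `L + 1` and leaves the one at `0`
alone. -/
theorem signedHom_w {n L : ℕ} (hL : 1 ≤ L) (hLn : L < n) :
    signedHom n (w n L) = negAt n 0 * negAt n L := by
  induction L, hL using Nat.le_induction with
  | base =>
    rw [w_one, gen_comm_gen_zero hLn, map_mul, signedHom_gen (by omega), signedHom_gen hLn,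
      signedGen_zero_mul_one hLn]
  | succ L hL ih =>
    rw [w_succ hL, map_mul, map_mul, ih (by omega), signedHom_gen hLn, signedGen,
      if_neg (by omega), ← mul_assoc, ← negAt_comm_sgen (by omega) hLn (by omega),
      mul_assoc (negAt n 0), sgen_mul_negAt hLn, mul_assoc, mul_assoc, permHom_sgen_sq, mul_one]

/-! ### The lower bound for the length -/

/-- The number of positive roots of type `D` that are negative on the pair of entries `u, v`. -/
def negRoots (u v : ℤ) : ℕ :=
  (if v < u then 1 else 0) + if u + v < 0 then 1 else 0

/-- Negating the left entry of a pair exchanges the two indicators in `negRoots`, and position `0`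
is always on the left. -/
theorem pairSum_negAt_zero {n : ℕ} (a : Fin n → ℤ) :
    pairSum negRoots (negAt n 0 a) = pairSum negRoots a := by
  refine Finset.sum_congr rfl fun ⟨x, y⟩ _ ↦ ?_
  simp only [Fin.lt_def, negAt, negRoots]
  split_ifs <;> omega

/-- An adjacent exchange affects one pair, and there only the indicator of `v < u`, since `u + v` is
symmetric. The case of `s_{1'}` reduces to `s_1` because the conjugating sign change preserves the
count. -/
theorem pairSum_signedGen_le {n : ℕ} (i : ℕ) (a : Fin n → ℤ) :
    pairSum negRoots (signedGen n i a) ≤ pairSum negRoots a + 1 := by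
  have hperm : ∀ j, ∀ b : Fin n → ℤ,
      pairSum negRoots (permHom n (sgen n j) b) ≤ pairSum negRoots b + 1 := by
    intro j b
    by_cases hj : 1 ≤ j ∧ j < n
    · have hpq : ((⟨j - 1, by omega⟩ : Fin n) : ℕ) + 1 = ((⟨j, hj.2⟩ : Fin n) : ℕ) := by
        simp; omega
      have h := pairSum_swap negRoots b hpq
      have h2 : permHom n (sgen n j) b = b ∘ Equiv.swap ⟨j - 1, by omega⟩ ⟨j, hj.2⟩ := by
        rw [← sgen_unop hpq]
        rfl
      rw [h2]
      have : ∀ u v, negRoots v u ≤ negRoots u v + 1 := by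
        intro u v
        unfold negRoots
        split_ifs <;> omega
      have := this (b ⟨j - 1, by omega⟩) (b ⟨j, hj.2⟩)
      omega
    · have h1 : sgen n j = 1 := by rw [sgen, dif_neg hj, MulOpposite.op_one]
      rw [h1, map_one]
      exact Nat.le_succ _
  unfold signedGen
  split_ifs
  · rw [end_mul_apply, end_mul_apply,
      pairSum_negAt_zero, ← pairSum_negAt_zero a]
    exact hperm _ _
  · exact hperm _ _

/-- The sequence `1, 2, …, n`. -/
def idSeq (n : ℕ) : Fin n → ℤ := fun x ↦ (x : ℤ) + 1

theorem pairSum_le_length {n : ℕ} (π : D n) :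
    pairSum negRoots (signedHom n π (idSeq n)) ≤ length π := by
  obtain ⟨ω, hω, h⟩ := (coxeterMatrix n).toCoxeterSystem.exists_isReduced π
  have hlen : length π = ω.length := by rw [h]; exact hω
  rw [hlen, h]
  clear hω h hlen
  induction ω with
  | nil =>
    rw [CoxeterSystem.wordProd_nil, map_one, List.length_nil, Nat.le_zero]
    refine Finset.sum_eq_zero fun ⟨x, y⟩ _ ↦ ?_
    change (if x < y then negRoots (x + 1) (y + 1) else 0) = 0
    simp only [negRoots, Fin.lt_def]
    split_ifs <;> omega
  | cons i ω ih =>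
    rw [CoxeterSystem.wordProd_cons, map_mul, List.length_cons, end_mul_apply]
    have : signedHom n ((coxeterMatrix n).toCoxeterSystem.simple i) = signedGen n i :=
      (coxeterMatrix n).toCoxeterSystem.lift_apply_simple (isLiftable_signedGen n) i
    rw [this]
    exact (pairSum_signedGen_le _ _).trans (by omega)

/-- All entries are positive before the sign change. A pair `(u, v)` with `v` in position `q` goes
from `[v < u]` to `1 + [u < v]`, a gain of `2` exactly when `u < v`; a pair with `q` on the left
keeps its count. -/
theorem pairSum_negAt {n : ℕ} (σ : Equiv.Perm (Fin n)) (q : Fin n) :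
    pairSum negRoots (negAt n q (idSeq n ∘ σ)) = inversions σ + 2 * smallerBefore σ q := by
  have h : smallerBefore σ q =
      ∑ r : Fin n × Fin n, if r.2 = q then (if r.1 < q ∧ σ r.1 < σ q then 1 else 0) else 0 := by
    rw [smallerBefore, Finset.card_filter, Fintype.sum_prod_type]
    simp
  rw [inversions_eq_pairSum, h, pairSum, pairSum, Finset.mul_sum, ← Finset.sum_add_distrib]
  refine Finset.sum_congr rfl fun ⟨x, y⟩ _ ↦ ?_
  have hxy : (σ x : ℕ) = σ y → (x : ℕ) = y := fun h ↦ by rw [σ.injective (Fin.ext h)]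
  have hy : (y : ℕ) = q → (σ y : ℕ) = σ q := fun h ↦ by rw [Fin.ext h]
  simp only [Fin.lt_def, negAt, negRoots, idSeq, Function.comp_apply, Fin.ext_iff]
  split_ifs <;> omega

theorem length_w_mul {n L : ℕ} (hL : 1 ≤ L) (hLn : L < n) {u : D n} (hu : u ∈ parabolic n) :
    length (w n L * u) =
      inversions (Φ n u).unop + 2 * smallerBefore (Φ n u).unop ⟨L, hLn⟩ := by
  refine le_antisymm (length_w_mul_le hL hLn hu) ?_
  refine le_of_eq_of_le ?_ (pairSum_le_length _)
  rw [map_mul, signedHom_w hL hLn, signedHom_of_mem_parabolic hu, end_mul_apply,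
    end_mul_apply, pairSum_negAt_zero]
  exact (pairSum_negAt (Φ n u).unop ⟨L, hLn⟩).symm

/-- By `w_succ`, `w_L` is a conjugate of `s_1 s_{1'}`, which `Φ` sends to `s_1 s_1`. -/
theorem Φ_w {n L : ℕ} (hL : 1 ≤ L) (hLn : L < n) : Φ n (w n L) = 1 := by
  induction L, hL using Nat.le_induction with
  | base =>
    rw [w_one, map_mul, Φ_gen hLn, Φ_gen (by omega)]
    exact sgen_sq n 1
  | succ L hL ih =>
    rw [w_succ hL, map_mul, map_mul, ih (by omega), mul_one, Φ_gen hLn, sgen_sq]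

end TypeD

/-- The canonical form of `π' = Φ(π)` has `m + 1 ≥ 1` factors, indexed from `0` to `m`. -/
theorem mainTheorem5 (n m : ℕ) (π πo : TypeD.D n) (k e : Fin (m + 1) → ℕ) (L : ℕ)
    (hπ' : TypeD.IsElementary (TypeD.Φ n π) k e)
    (hL1 : 1 ≤ L) (hLn : L ≤ n - 1)
    (hπo : πo ∈ TypeD.parabolic n)
    (hπ : π = TypeD.w n L * πo) :
    (L < ∑ j, e j →
      TypeD.length π = 2 * L + TypeD.inversions (TypeD.Φ n π).unop) ∧
    (L = ∑ j, e j → ∑ j, e j < k 0 →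
      TypeD.length π = TypeD.inversions (TypeD.Φ n π).unop) ∧
    (∑ j, e j < L → L < k 0 →
      (TypeD.length π : ℤ) =
        2 * ((L : ℤ) - TypeD.maj (TypeD.Φ n π).unop) +
          TypeD.inversions (TypeD.Φ n π).unop) ∧
    (∀ r : Fin m, k r.castSucc ≤ L → L < k r.succ →
      (TypeD.length π : ℤ) =
        2 * ((L : ℤ) - ∑ j ∈ Finset.Ioi r.castSucc, (e j : ℤ)) +
          TypeD.inversions (TypeD.Φ n π).unop) ∧
    (k (Fin.last m) ≤ L →
      TypeD.length π = 2 * L + TypeD.inversions (TypeD.Φ n π).unop) := by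
  have hlt : L < n := by omega
  have hlen : TypeD.length π = TypeD.inversions (TypeD.Φ n π).unop +
      2 * TypeD.smallerBefore (TypeD.Φ n π).unop ⟨L, hlt⟩ := by
    have hΦ : TypeD.Φ n π = TypeD.Φ n πo := by rw [hπ, map_mul, TypeD.Φ_w hL1 hlt, one_mul]
    rw [hΦ, hπ]
    exact TypeD.length_w_mul hL1 hlt hπo
  rw [hπ'.smallerBefore_eq] at hlen
  simp only at hlen
  have hmono := hπ'.strictMono.monotone
  have hsum := hπ'.sum_le
  have hzero : L < k 0 → (∑ j, if k j ≤ L then e j else 0) = 0 := fun h ↦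
    Finset.sum_eq_zero fun j _ ↦ if_neg (by have := hmono (Fin.zero_le j); omega)
  -- With `E` the exponent sum, the number of smaller predecessors in the five cases is `L`, `0`, `L
  -- - E` (where `E` is the major index), `L` minus the exponents after `r`, and `L`.
  refine ⟨fun h ↦ ?_, fun h1 h2 ↦ ?_, fun h1 h2 ↦ ?_, fun r h1 h2 ↦ ?_, fun h ↦ ?_⟩
  · rw [if_pos h] at hlen
    omega
  · rw [if_neg (by omega), hzero (by omega)] at hlen
    omega
  · rw [if_neg (by omega), hzero h2] at hlen
    rw [hπ'.maj_eq (by omega)]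
    omega
  · have hk0 := hmono (Fin.zero_le r.castSucc)
    rw [if_neg (by omega)] at hlen
    have hsplit : (∑ j, if k j ≤ L then e j else 0) + ∑ j ∈ Finset.Ioi r.castSucc, e j =
        ∑ j, e j := by
      have : Finset.Ioi r.castSucc = Finset.univ.filter fun j ↦ ¬ k j ≤ L := by
        ext j
        simp only [Finset.mem_Ioi, Finset.mem_filter, Finset.mem_univ, true_and, not_le]
        constructor
        · intro hj
          exact h2.trans_le (hmono (Fin.castSucc_lt_iff_succ_le.1 hj))
        · intro hj
          by_contra hc
          have := hmono (not_lt.1 hc)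
          omega
      rw [this, ← Finset.sum_filter, Finset.sum_filter_add_sum_filter_not]
    rw [← Nat.cast_sum]
    omega
  · have hk0 := hmono (Fin.zero_le (Fin.last m))
    have hall : (∑ j, if k j ≤ L then e j else 0) = ∑ j, e j :=
      Finset.sum_congr rfl fun j _ ↦ if_pos ((hmono (Fin.le_last j)).trans h)
    rw [if_neg (by omega), hall] at hlen
    omega
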